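/- Let $X\subseteq\mathbb{R}^d$ be equipped with a probability measure $\rho$, and let $\phi_1,\dots,\phi_n\in L^2_\rho(X)$ be complex-valued functions that are linearly independent in $L^2_\rho(X)$. Write $\phi(x)=[\phi_1(x),\dots,\phi_n(x)]^\top$, let $G\in\mathbb{C}^{n\times n}$ be the Gram matrix $G_{ij}=\int_X\phi_i\overline{\phi_j}\,d\rho$ with eigenvalues $\lambda_i(G)$, and for $\epsilon\ge 0$ put $$k_n^\epsilon(x)=\phi(x)^*(G+\epsilon^2I)^{-1}\phi(x),\qquad n^\epsilon=\sum_{i=1}^n\frac{\lambda_i(G)}{\lambda_i(G)+\epsilon^2}.$$ Assume $\|G\|_2\ge\epsilon^2$ (spectral norm) and $k_n^\epsilon(x)>0$ for all $x\in X$. Let $u:X\to\mathbb{R}$ be $\rho$-integrable with $u(x)\ge k_n^\epsilon(x)$ for all $x\in X$, and define the probability measure $\mu_u$ on $X$ by $$w_u\,d\mu_u=d\rho,\qquad w_u=\frac{\|u\|_{L^1_\rho(X)}}{u}.$$ Let $\Delta>0$, $0<\gamma<1$, and let $m$ be a natural number with $$m\ge c_\Delta\log(16n^\epsilon/\gamma)\,\|u\|_{L^1_\rho(X)},\qquad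 c_\Delta=\frac{1+2\Delta/3}{\Delta^2/2}.$$ If $x_1,\dots,x_m$ are drawn i.i.d. from $\mu_u$ and $(G_m)_{ij}=\sum_{k=1}^m\frac{w_u(x_k)}{m}\phi_i(x_k)\overline{\phi_j(x_k)}$, then with probability at least $1-\gamma$ $$(1-\Delta)(G+\epsilon^2I)\preceq G_m+\epsilon^2I\preceq(1+\Delta)(G+\epsilon^2I),$$ where $A\preceq B$ means that $B-A$ is positive semidefinite. -/

import Mathlib

open MeasureTheory ProbabilityTheory
open scoped MatrixOrder

namespace ChristoffelSampling

noncomputable section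

/-- The continuous Gram matrix `G i j = ⟨φ i, φ j⟩ = ∫ φ i * conj (φ j) dρ`. -/
def gram {α : Type*} [MeasurableSpace α] {n : ℕ} (ρ : Measure α) (φ : Fin n → α → ℂ) :
    Matrix (Fin n) (Fin n) ℂ :=
  Matrix.of fun i j => ∫ x, φ i x * star (φ j x) ∂ρ

theorem gram_isHermitian {α : Type*} [MeasurableSpace α] {n : ℕ} (ρ : Measure α)
    (φ : Fin n → α → ℂ) : (gram ρ φ).IsHermitian := by
  ext i j
  simp only [gram, Matrix.conjTranspose_apply, Matrix.of_apply, Complex.star_def]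
  rw [← integral_conj]
  refine integral_congr_ae (Filter.Eventually.of_forall fun x => ?_)
  simp [mul_comm]

/-- The regularized matrix `A + ε² I`. -/
def regularized {n : ℕ} (ε : ℝ) (A : Matrix (Fin n) (Fin n) ℂ) : Matrix (Fin n) (Fin n) ℂ :=
  A + (ε ^ 2) • (1 : Matrix (Fin n) (Fin n) ℂ)

/-- The numerical inverse Christoffel function `φ(x)^* (G + ε² I)⁻¹ φ(x)`, where
`φ(x) = (φ 1 x, …, φ n x)`. The matrix is Hermitian, so the quadratic form is real and taking the
real part only changes the type. -/
def invChristoffel {α : Type*} [MeasurableSpace α] {n : ℕ} (ρ : Measure α) (φ : Fin n → α → ℂ)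
    (ε : ℝ) (x : α) : ℝ :=
  (star (fun i => φ i x) ⬝ᵥ
    Matrix.mulVec (regularized ε (gram ρ φ))⁻¹ (fun i => φ i x)).re

/-- The numerical dimension `∑ i, λ i / (λ i + ε²)`, with `λ i` the eigenvalues of `G`. -/
def numDim {α : Type*} [MeasurableSpace α] {n : ℕ} (ρ : Measure α) (φ : Fin n → α → ℂ)
    (ε : ℝ) : ℝ :=
  ∑ i, (gram_isHermitian ρ φ).eigenvalues i / ((gram_isHermitian ρ φ).eigenvalues i + ε ^ 2)

/-- The norm of `u` in `L¹(ρ)` (for integrable `u`). -/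
def l1Norm {α : Type*} [MeasurableSpace α] (ρ : Measure α) (u : α → ℝ) : ℝ :=
  ∫ x, |u x| ∂ρ

/-- The weight function `w_u = ‖u‖_{L¹(ρ)} / u`. -/
def weight {α : Type*} [MeasurableSpace α] (ρ : Measure α) (u : α → ℝ) (x : α) : ℝ :=
  l1Norm ρ u / u x

/-- The sampling measure `μ_u`, with density `1 / w_u = u / ‖u‖_{L¹(ρ)}` with respect to `ρ`. -/
def samplingMeasure {α : Type*} [MeasurableSpace α] (ρ : Measure α) (u : α → ℝ) : Measure α :=
  ρ.withDensity fun x => ENNReal.ofReal (u x / l1Norm ρ u)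

/-- The weighted discrete Gram matrix
`G_m i j = ∑ k, (w_u (x k) / m) * φ i (x k) * conj (φ j (x k))`. -/
def discreteGram {α : Type*} [MeasurableSpace α] {n m : ℕ} (ρ : Measure α) (φ : Fin n → α → ℂ)
    (u : α → ℝ) (x : Fin m → α) : Matrix (Fin n) (Fin n) ℂ :=
  Matrix.of fun i j =>
    ∑ k, ((weight ρ u (x k) / m : ℝ) : ℂ) * (φ i (x k) * star (φ j (x k)))

/-- The constant `c_Δ = (1 + 2Δ/3) / (Δ²/2)`. -/
def cDelta (Δ : ℝ) : ℝ := (1 + 2 * Δ / 3) / (Δ ^ 2 / 2)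

end

end ChristoffelSampling

/-! Write `B = G + ε²I` and choose `D` with `B⁻¹ = D*D`, so that `D B D* = 1`. Conjugation by `D`
turns the claim into a two-sided bound for a sum of `m` independent positive semidefinite matrices
`Z_k = w_u(x_k) Dφ(x_k)(Dφ(x_k))*`, with mean `M = D G D* ≤ 1` and `tr M = n^ε`. Each `Z_k` has rank
at most one, hence norm `w_u k_n^ε ≤ ‖u‖₁ = L`; this is where `u ≥ k_n^ε` enters.

The tail bound is a matrix Bernstein-type argument with `n^ε` in place of the dimension `n`. From
`Z² ≤ L Z`, the centred and rescaled summands `X` satisfy `E e^X ≤ 1 + κM`. Golden–Thompson and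
independence bound `E tr e^(S+X)` by `tr (E e^S · E e^X)`. Since `E S = 0` forces `E e^S ≥ 1` and `M
≤ 1`, the excess `a = E tr (e^S - 1)` obeys `a' ≤ (1 + κ) a + κ tr M`, so after `m` steps `a ≤ tr M
((1 + κ)^m - 1)`. Markov's inequality for `tr (e^S - S - 1)`, whose mean is this excess, gives the
tail. It is used once for each sign, at cost `γ/2` each.

Golden–Thompson itself follows from `re_trace_mul_pow_two_pow_le` and the Lie–Trotter formula. -/

section

open scoped ComplexOrder

/-! ### Trace inequalities at dyadic exponents -/

namespace Matrix

variable {n : Type*} [Fintype n]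

theorem trace_mul_pow_comm [DecidableEq n] {R : Type*} [CommRing R] (A B : Matrix n n R) (k : ℕ) :
    ((A * B) ^ k).trace = ((B * A) ^ k).trace := by
  cases k with
  | zero => simp
  | succ k =>
    have h : (A * B) ^ (k + 1) = A * ((B * A) ^ k * B) := by
      have : ∀ k, (A * B) ^ k * A = A * (B * A) ^ k := fun k => by
        induction k with
        | zero => simp
        | succ k ih => rw [pow_succ, pow_succ, mul_assoc, mul_assoc A B A, ← mul_assoc, ih,
            mul_assoc]
      rw [pow_succ, ← mul_assoc, this, mul_assoc]
    rw [h, trace_mul_comm, mul_assoc, ← pow_succ]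

theorem re_trace_sq_nonneg {C : Matrix n n ℂ} (hC : C.IsHermitian) : 0 ≤ (C * C).trace.re := by
  have h := (posSemidef_conjTranspose_mul_self C).trace_nonneg
  rw [hC.eq] at h
  exact (Complex.le_def.1 h).1

/-- Expand `tr (Z - Z*)(Z - Z*)* ≥ 0`. -/
theorem re_trace_mul_self_le (Z : Matrix n n ℂ) : (Z * Z).trace.re ≤ (Z * Zᴴ).trace.re := by
  have h := (Complex.le_def.1 (posSemidef_self_mul_conjTranspose (Z - Zᴴ)).trace_nonneg).1
  have e1 : (Zᴴ * Zᴴ).trace.re = (Z * Z).trace.re := by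
    rw [← conjTranspose_mul, trace_conjTranspose]; simp
  simp only [conjTranspose_sub, conjTranspose_conjTranspose, sub_mul, mul_sub, trace_sub,
    Complex.sub_re, trace_mul_comm Zᴴ Z, e1, Complex.zero_re] at h
  linarith

variable [DecidableEq n]

/-- The arithmetic-geometric mean form of the trace Hölder inequality at dyadic exponent `2 ^ i`. -/
def DyadicTraceAMGM (n : Type*) [Fintype n] [DecidableEq n] (i : ℕ) : Prop :=
  ∀ C D : Matrix n n ℂ, C.IsHermitian → D.IsHermitian →
    ((C * D) ^ 2 ^ i).trace.re ≤
      ((C ^ 2 ^ (i + 1)).trace.re + (D ^ 2 ^ (i + 1)).trace.re) / 2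

/-- Cyclicity regroups `Z Z Z* Z*` as the product of the Hermitian matrices `ZZ*` and `Z*Z`. Their
powers have equal traces, so the mean in the AM-GM bound collapses to a single term. -/
theorem re_trace_sq_mul_conjTranspose_pow_le {j : ℕ} (h : DyadicTraceAMGM n j)
    (Z : Matrix n n ℂ) :
    ((Z ^ 2 * (Z ^ 2)ᴴ) ^ 2 ^ j).trace.re ≤ ((Z * Zᴴ) ^ 2 ^ (j + 1)).trace.re := by
  have e : ((Z ^ 2 * (Z ^ 2)ᴴ) ^ 2 ^ j).trace = (((Z * Zᴴ) * (Zᴴ * Z)) ^ 2 ^ j).trace := by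
    rw [show Z ^ 2 * (Z ^ 2)ᴴ = Z * (Z * Zᴴ * Zᴴ) by simp [pow_two, mul_assoc],
      trace_mul_pow_comm]
    simp [mul_assoc]
  rw [e]
  refine (h _ _ (isHermitian_mul_conjTranspose_self Z)
    (isHermitian_conjTranspose_mul_self Z)).trans ?_
  rw [trace_mul_pow_comm Zᴴ Z]
  linarith

theorem re_trace_pow_mul_conjTranspose_pow_le (i : ℕ) :
    ∀ (j : ℕ), (∀ k < j + i, DyadicTraceAMGM n k) → ∀ Z : Matrix n n ℂ,
    ((Z ^ 2 ^ i * (Z ^ 2 ^ i)ᴴ) ^ 2 ^ j).trace.re ≤ ((Z * Zᴴ) ^ 2 ^ (j + i)).trace.re := by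
  induction i with
  | zero => intro j _ Z; simp
  | succ i ih =>
    intro j h Z
    rw [show Z ^ 2 ^ (i + 1) = (Z ^ 2) ^ 2 ^ i by rw [← pow_mul, pow_succ']]
    exact (ih j (fun k hk => h k (by omega)) (Z ^ 2)).trans
      (re_trace_sq_mul_conjTranspose_pow_le (h _ (by omega)) Z)

theorem re_trace_pow_le_of_dyadicTraceAMGM {i : ℕ} (h : ∀ k < i, DyadicTraceAMGM n k)
    (Z : Matrix n n ℂ) :
    (Z ^ 2 ^ (i + 1)).trace.re ≤ ((Z * Zᴴ) ^ 2 ^ i).trace.re := by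
  rw [pow_succ, pow_mul, pow_two]
  refine (re_trace_mul_self_le _).trans ?_
  simpa using re_trace_pow_mul_conjTranspose_pow_le i 0 (by simpa using h) Z

theorem re_trace_mul_pow_le_of_dyadicTraceAMGM {i : ℕ} (h : ∀ k < i, DyadicTraceAMGM n k)
    {C D : Matrix n n ℂ} (hC : C.IsHermitian) (hD : D.IsHermitian) :
    ((C * D) ^ 2 ^ (i + 1)).trace.re ≤ ((C ^ 2 * D ^ 2) ^ 2 ^ i).trace.re := by
  refine (re_trace_pow_le_of_dyadicTraceAMGM h _).trans ?_
  rw [conjTranspose_mul, hC.eq, hD.eq, show C * D * (D * C) = C * (D * D * C) by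
    simp [mul_assoc], trace_mul_pow_comm, show D * D * C * C = D ^ 2 * C ^ 2 by
    simp [mul_assoc, pow_two], trace_mul_pow_comm]

/-- The base case is `tr (C - D)² ≥ 0`. Otherwise the lower levels trade `(CD)^(2^(i+1))` for
`(C²D²)^(2^i)`, to which level `i` applies with `C²`, `D²`. -/
theorem dyadicTraceAMGM (i : ℕ) : DyadicTraceAMGM n i := by
  induction i using Nat.strong_induction_on with
  | _ i ih =>
    intro C D hC hD
    cases i with
    | zero =>
      have h := re_trace_sq_nonneg (hC.sub hD)
      simp only [sub_mul, mul_sub, trace_sub, Complex.sub_re, trace_mul_comm D C] at h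
      simp only [pow_zero, pow_one, zero_add, pow_two]
      linarith
    | succ i =>
      refine (re_trace_mul_pow_le_of_dyadicTraceAMGM (fun k hk => ih k (by omega)) hC hD).trans ?_
      have := ih i (by omega) (C ^ 2) (D ^ 2) (hC.pow 2) (hD.pow 2)
      simpa only [← pow_mul, ← pow_succ'] using this

theorem re_trace_mul_pow_two_pow_le (k : ℕ) {A B : Matrix n n ℂ} (hA : A.IsHermitian)
    (hB : B.IsHermitian) :
    ((A * B) ^ 2 ^ k).trace.re ≤ (A ^ 2 ^ k * B ^ 2 ^ k).trace.re := by
  induction k generalizing A B with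
  | zero => simp
  | succ k ih =>
    refine (re_trace_mul_pow_le_of_dyadicTraceAMGM (fun k _ => dyadicTraceAMGM k) hA hB).trans ?_
    simpa only [← pow_mul, ← pow_succ'] using ih (hA.pow 2) (hB.pow 2)

end Matrix

/-! ### The Lie–Trotter product formula -/

section Trotter

open NormedSpace Filter Topology

variable {𝔸 : Type*} [NormedRing 𝔸] [NormOneClass 𝔸]

/-- Telescoping; `1 ≤ c` allows the crude factor `c ^ N` instead of `c ^ (N - 1)`. -/
theorem norm_pow_sub_pow_le {X Y : 𝔸} {c : ℝ} (hX : ‖X‖ ≤ c) (hY : ‖Y‖ ≤ c) (hc : 1 ≤ c)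
    (N : ℕ) : ‖X ^ N - Y ^ N‖ ≤ N * c ^ N * ‖X - Y‖ := by
  induction N with
  | zero => simp
  | succ N ih =>
    have e : X ^ (N + 1) - Y ^ (N + 1) = X ^ N * (X - Y) + (X ^ N - Y ^ N) * Y := by
      rw [pow_succ, pow_succ]; noncomm_ring
    have h1 : ‖X ^ N‖ ≤ c ^ N := (norm_pow_le _ _).trans (by gcongr)
    have hcN : c ^ N ≤ c ^ (N + 1) := pow_le_pow_right₀ hc (by omega)
    calc ‖X ^ (N + 1) - Y ^ (N + 1)‖
        ≤ ‖X ^ N‖ * ‖X - Y‖ + ‖X ^ N - Y ^ N‖ * ‖Y‖ := by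
          rw [e]
          exact (norm_add_le _ _).trans (add_le_add (norm_mul_le _ _) (norm_mul_le _ _))
      _ ≤ c ^ (N + 1) * ‖X - Y‖ + (N * c ^ N * ‖X - Y‖) * c := by
          gcongr
          exact h1.trans hcN
      _ = (N + 1 : ℕ) * c ^ (N + 1) * ‖X - Y‖ := by push_cast; ring

variable [NormedAlgebra ℝ 𝔸]

theorem norm_normedSpace_exp_le (x : 𝔸) : ‖NormedSpace.exp x‖ ≤ Real.exp ‖x‖ := by
  let _ : NormedAlgebra ℚ 𝔸 := NormedAlgebra.restrictScalars ℚ ℝ 𝔸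
  have hs := NormedSpace.norm_expSeries_summable' (𝕂 := ℝ) x
  rw [NormedSpace.exp_eq_tsum ℝ, Real.exp_eq_exp_ℝ, NormedSpace.exp_eq_tsum ℝ]
  refine (norm_tsum_le_tsum_norm hs).trans ?_
  refine Summable.tsum_le_tsum (fun k => ?_) hs (NormedSpace.expSeries_summable' (𝕂 := ℝ) ‖x‖)
  rw [norm_smul, Real.norm_of_nonneg (by positivity), smul_eq_mul]
  gcongr
  exact norm_pow_le x k

variable [CompleteSpace 𝔸]

/-- The Lie–Trotter product formula. -/
theorem tendsto_exp_mul_exp_pow (A B : 𝔸) :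
    Tendsto (fun N : ℕ => (exp ((N : ℝ)⁻¹ • A) * exp ((N : ℝ)⁻¹ • B)) ^ N) atTop
      (𝓝 (exp (A + B))) := by
  let _ : NormedAlgebra ℚ 𝔸 := NormedAlgebra.restrictScalars ℚ ℝ 𝔸
  -- The one-step error `f` vanishes to first order at `0`, so `N ‖f(1/N)‖ → 0`. Telescoping loses
  -- exactly the factor `N`, times a constant.
  set f : ℝ → 𝔸 := fun t => exp (t • A) * exp (t • B) - exp (t • (A + B)) with hf
  have hd : HasDerivAt f 0 0 := by
    have h := ((hasDerivAt_exp_smul_const (𝕂 := ℝ) A (0 : ℝ)).mul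
      (hasDerivAt_exp_smul_const (𝕂 := ℝ) B (0 : ℝ))).sub
      (hasDerivAt_exp_smul_const (𝕂 := ℝ) (A + B) (0 : ℝ))
    exact h.congr_deriv (by simp)
  have hf0 : f 0 = 0 := by simp [hf]
  have hslope : Tendsto (fun N : ℕ => (N : ℝ) * ‖f (N : ℝ)⁻¹‖) atTop (𝓝 0) := by
    have h1 := hd.tendsto_slope
    have h2 : Tendsto (fun N : ℕ => (N : ℝ)⁻¹) atTop (𝓝[≠] 0) := by
      refine tendsto_nhdsWithin_iff.2 ⟨tendsto_inv_atTop_nhds_zero_nat, ?_⟩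
      filter_upwards [eventually_gt_atTop 0] with N hN
      simpa using hN.ne'
    have h3 := (h1.comp h2).norm
    rw [norm_zero] at h3
    refine h3.congr fun N => ?_
    simp [slope, hf0, norm_smul]
  set c : ℝ := ‖A‖ + ‖B‖
  have hbound : ∀ N : ℕ, 0 < N →
      ‖(exp ((N : ℝ)⁻¹ • A) * exp ((N : ℝ)⁻¹ • B)) ^ N - exp (A + B)‖ ≤
        Real.exp c * ((N : ℝ) * ‖f (N : ℝ)⁻¹‖) := by
    intro N hN
    have hN' : (N : ℝ) ≠ 0 := by positivity
    have e1 : exp (A + B) = exp ((N : ℝ)⁻¹ • (A + B)) ^ N := by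
      rw [← NormedSpace.exp_nsmul, ← Nat.cast_smul_eq_nsmul ℝ, smul_smul, mul_inv_cancel₀ hN',
        one_smul]
    have hn : ∀ x : 𝔸, ‖(N : ℝ)⁻¹ • x‖ = (N : ℝ)⁻¹ * ‖x‖ := fun x => by simp [norm_smul]
    have hX : ‖exp ((N : ℝ)⁻¹ • A) * exp ((N : ℝ)⁻¹ • B)‖ ≤ Real.exp ((N : ℝ)⁻¹ * c) := by
      refine (norm_mul_le _ _).trans ?_
      rw [mul_add, Real.exp_add, ← hn, ← hn]
      gcongr <;> exact norm_normedSpace_exp_le _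
    have hY : ‖exp ((N : ℝ)⁻¹ • (A + B))‖ ≤ Real.exp ((N : ℝ)⁻¹ * c) := by
      refine (norm_normedSpace_exp_le _).trans (Real.exp_le_exp.2 ?_)
      rw [hn]
      gcongr
      exact norm_add_le _ _
    have hc : 1 ≤ Real.exp ((N : ℝ)⁻¹ * c) := Real.one_le_exp (by positivity)
    rw [e1]
    refine (norm_pow_sub_pow_le hX hY hc N).trans_eq ?_
    rw [← Real.exp_nat_mul, mul_inv_cancel_left₀ hN']
    ring
  rw [tendsto_iff_norm_sub_tendsto_zero]
  refine squeeze_zero' (Eventually.of_forall fun _ => norm_nonneg _) ?_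
    (by simpa using hslope.const_mul (Real.exp c))
  filter_upwards [eventually_gt_atTop 0] with N hN using hbound N hN

end Trotter

/-! ### Golden–Thompson -/

namespace Matrix

open NormedSpace Filter Topology

variable {n : Type*} [Fintype n] [DecidableEq n]

/-- The Golden–Thompson inequality. -/
theorem re_trace_exp_add_le [Nonempty n] {A B : Matrix n n ℂ} (hA : A.IsHermitian)
    (hB : B.IsHermitian) : (exp (A + B)).trace.re ≤ (exp A * exp B).trace.re := by
  have key : Tendsto (fun N : ℕ => (exp ((N : ℝ)⁻¹ • A) * exp ((N : ℝ)⁻¹ • B)) ^ N) atTop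
      (𝓝 (exp (A + B))) := by
    open scoped Matrix.Norms.L2Operator in
    exact tendsto_exp_mul_exp_pow A B
  -- The trace inequality holds at powers of two, so the Trotter limit is taken along `N = 2 ^ k`.
  have h2 : Tendsto (fun k : ℕ => 2 ^ k) atTop atTop := tendsto_pow_atTop_atTop_of_one_lt (by norm_num)
  have hc : Continuous fun M : Matrix n n ℂ => M.trace.re :=
    Complex.continuous_re.comp (continuous_id.matrix_trace)
  refine le_of_tendsto ((hc.tendsto _).comp (key.comp h2)) (Eventually.of_forall fun k => ?_)
  simp only [Function.comp]
  have hr : ∀ {M : Matrix n n ℂ}, M.IsHermitian →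
      (exp (((2 ^ k : ℕ) : ℝ)⁻¹ • M)).IsHermitian ∧
        exp (((2 ^ k : ℕ) : ℝ)⁻¹ • M) ^ 2 ^ k = exp M := by
    intro M hM
    refine ⟨IsHermitian.exp (by simp [IsHermitian, conjTranspose_smul, hM.eq]), ?_⟩
    rw [← Matrix.exp_nsmul, ← Nat.cast_smul_eq_nsmul ℝ, smul_smul, mul_inv_cancel₀ (by positivity),
      one_smul]
  refine (re_trace_mul_pow_two_pow_le k (hr hA).1 (hr hB).1).trans_eq ?_
  rw [(hr hA).2, (hr hB).2]

end Matrix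

/-! ### Scalar exponential bounds and their transfer to Hermitian matrices -/

theorem Real.exp_sub_one_sub_id_nonneg (x : ℝ) : 0 ≤ Real.exp x - x - 1 := by
  linarith [Real.add_one_le_exp x]

theorem Real.exp_sub_id_sub_one_mono {s t : ℝ} (hs : 0 ≤ s) (hst : s ≤ t) :
    Real.exp s - s - 1 ≤ Real.exp t - t - 1 := by
  have h1 : Real.exp t = Real.exp s * Real.exp (t - s) := by rw [← Real.exp_add]; congr 1; ring
  have h2 := Real.add_one_le_exp (t - s)
  have h3 := Real.one_le_exp hs
  nlinarith

/-- Compare the Taylor series from order two on, term by term: `x^(k+2) ≤ x² R^k`. -/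
theorem Real.exp_le_one_add_add_mul_sq {R x : ℝ} (hR : 0 < R) (hx : |x| ≤ R) :
    Real.exp x ≤ 1 + x + (Real.exp R - R - 1) / R ^ 2 * x ^ 2 := by
  have hs : ∀ y : ℝ, HasSum (fun k : ℕ => y ^ (k + 2) / ((k + 2).factorial : ℝ))
      (Real.exp y - y - 1) := fun y => by
    have h := NormedSpace.expSeries_div_hasSum_exp (𝔸 := ℝ) y
    rw [← Real.exp_eq_exp_ℝ] at h
    have h2 := (hasSum_nat_add_iff' 2).2 h
    simpa [Finset.sum_range_succ, sub_sub, add_comm] using h2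
  have h := hasSum_le (fun k => ?_) (hs x) ((hs R).mul_left (x ^ 2 / R ^ 2))
  · calc Real.exp x = 1 + x + (Real.exp x - x - 1) := by ring
      _ ≤ 1 + x + x ^ 2 / R ^ 2 * (Real.exp R - R - 1) := by gcongr
      _ = _ := by ring
  · have h1 : x ^ k ≤ R ^ k :=
      (le_abs_self _).trans ((abs_pow x k).trans_le (pow_le_pow_left₀ (abs_nonneg x) hx k))
    have e : x ^ 2 / R ^ 2 * (R ^ (k + 2) / ((k + 2).factorial : ℝ)) =
        x ^ 2 * R ^ k / ((k + 2).factorial : ℝ) := by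
      field_simp
      ring
    rw [e, pow_add, mul_comm]
    gcongr

namespace Matrix

variable {n : Type*} [Fintype n]

theorem re_trace_mono {A B : Matrix n n ℂ} (h : A ≤ B) : A.trace.re ≤ B.trace.re := by
  have := (Complex.le_def.1 (le_iff.1 h).trace_nonneg).1
  simpa [trace_sub] using this

theorem re_trace_mul_nonneg {A B : Matrix n n ℂ} (hA : 0 ≤ A) (hB : 0 ≤ B) :
    0 ≤ (A * B).trace.re := by
  classical
  obtain ⟨C, rfl⟩ := CStarAlgebra.nonneg_iff_eq_star_mul_self.mp hA
  have := ((nonneg_iff_posSemidef.1 hB).mul_mul_conjTranspose_same C).trace_nonneg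
  rw [mul_assoc, trace_mul_comm]
  exact (Complex.le_def.1 this).1

theorem re_trace_mul_le_mul_left {A B C : Matrix n n ℂ} (hA : 0 ≤ A) (h : B ≤ C) :
    (A * B).trace.re ≤ (A * C).trace.re := by
  have := re_trace_mul_nonneg hA (sub_nonneg.2 h)
  simpa [mul_sub, trace_sub] using this

variable [DecidableEq n]

open scoped Matrix.Norms.L2Operator in
theorem IsHermitian.cfc_exp {A : Matrix n n ℂ} (hA : A.IsHermitian) :
    cfc Real.exp A = NormedSpace.exp A :=
  CFC.real_exp_eq_normedSpace_exp (a := A) hA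

theorem IsHermitian.one_add_le_exp {A : Matrix n n ℂ} (hA : A.IsHermitian) : 1 + A ≤ NormedSpace.exp A := by
  have hA' : IsSelfAdjoint A := hA
  have e : cfc (fun x : ℝ => 1 + x) A = 1 + A := by
    rw [cfc_add (R := ℝ) (a := A) (fun _ => 1) (fun x => x), cfc_const_one ℝ A, cfc_id' ℝ A]
  rw [← hA.cfc_exp, ← e]
  exact cfc_mono fun x _ => by linarith [Real.add_one_le_exp x]

theorem IsHermitian.exp_nonneg {A : Matrix n n ℂ} (hA : A.IsHermitian) : 0 ≤ NormedSpace.exp A := by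
  rw [← hA.cfc_exp]
  exact cfc_nonneg fun x _ => (Real.exp_pos x).le

theorem IsHermitian.exp_le_of_le {A : Matrix n n ℂ} (hA : A.IsHermitian) {R : ℝ} (hR : 0 < R)
    (h1 : A ≤ R • 1) (h2 : -A ≤ R • 1) :
    NormedSpace.exp A ≤ 1 + A + ((Real.exp R - R - 1) / R ^ 2) • (A * A) := by
  have hA' : IsSelfAdjoint A := hA
  set g : ℝ := (Real.exp R - R - 1) / R ^ 2
  have e : cfc (fun x : ℝ => (1 + x) + g * x ^ 2) A = 1 + A + g • (A * A) := by
    rw [cfc_add (R := ℝ) (a := A) (fun x => 1 + x) (fun x => g * x ^ 2),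
      cfc_add (R := ℝ) (a := A) (fun _ => 1) (fun x => x), cfc_const_one ℝ A, cfc_id' ℝ A,
      cfc_const_mul g (fun x : ℝ => x ^ 2) A, cfc_pow_id A 2, pow_two]
  have u1 := (le_algebraMap_iff_spectrum_le hA').1 (h1.trans_eq (Algebra.algebraMap_eq_smul_one R).symm)
  have h2' : algebraMap ℝ (Matrix n n ℂ) (-R) ≤ A := by
    rw [Algebra.algebraMap_eq_smul_one, neg_smul]; exact neg_le.1 h2
  have u2 := (algebraMap_le_iff_le_spectrum hA').1 h2'
  rw [← hA.cfc_exp, ← e]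
  exact cfc_mono fun x hx => Real.exp_le_one_add_add_mul_sq hR (abs_le.2 ⟨u2 x hx, u1 x hx⟩)

theorem IsHermitian.re_trace_cfc {A : Matrix n n ℂ} (hA : A.IsHermitian) (f : ℝ → ℝ) :
    (cfc f A).trace.re = ∑ i, f (hA.eigenvalues i) := by
  rw [hA.cfc_eq, IsHermitian.cfc, Unitary.conjStarAlgAut_apply, trace_mul_cycle]
  simp [trace]

/-- Some eigenvalue exceeds `t`, and `e^x - x - 1 ≥ 0` lets the others be dropped. With `e^x` alone
the Markov step would bring in the full dimension `tr 1`. -/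
theorem IsHermitian.re_trace_exp_sub_ge {A : Matrix n n ℂ} (hA : A.IsHermitian) {t : ℝ}
    (ht : 0 ≤ t) (h : ¬ A ≤ t • 1) :
    Real.exp t - t - 1 ≤ (NormedSpace.exp A - A - 1).trace.re := by
  have hA' : IsSelfAdjoint A := hA
  have e : cfc (fun x : ℝ => Real.exp x - x - 1) A = NormedSpace.exp A - A - 1 := by
    rw [cfc_sub (R := ℝ) (a := A) (fun x => Real.exp x - x) (fun _ => 1),
      cfc_sub (R := ℝ) (a := A) Real.exp (fun x => x), cfc_const_one ℝ A, cfc_id' ℝ A, hA.cfc_exp]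
  rw [← e, hA.re_trace_cfc]
  rw [← Algebra.algebraMap_eq_smul_one, le_algebraMap_iff_spectrum_le hA'] at h
  push Not at h
  obtain ⟨x, hx, htx⟩ := h
  rw [hA.spectrum_real_eq_range_eigenvalues] at hx
  obtain ⟨i, rfl⟩ := hx
  exact (Real.exp_sub_id_sub_one_mono ht htx.le).trans
    (Finset.single_le_sum (f := fun i => Real.exp (hA.eigenvalues i) - hA.eigenvalues i - 1)
      (fun i _ => Real.exp_sub_one_sub_id_nonneg _) (Finset.mem_univ i))

end Matrix

namespace Matrix

/-! ### Exponential trace moments of independent sums -/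

section RandomMatrix

open scoped Matrix.Norms.L2Operator

variable {n : Type*} [Fintype n] [DecidableEq n]

noncomputable instance : MeasurableSpace (Matrix n n ℂ) := borel _

instance : BorelSpace (Matrix n n ℂ) := ⟨rfl⟩

instance : SecondCountableTopology (Matrix n n ℂ) :=
  inferInstanceAs (SecondCountableTopology (n → n → ℂ))

variable {Ω : Type*} [MeasurableSpace Ω] {P : Measure Ω}

/-- The real part of the trace, as a continuous real-linear functional. -/
noncomputable def reTraceCLM (n : Type*) [Fintype n] [DecidableEq n] : Matrix n n ℂ →L[ℝ] ℝ :=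
  LinearMap.toContinuousLinearMap
    (Complex.reLm ∘ₗ (traceLinearMap n ℂ ℂ).restrictScalars ℝ)

theorem reTraceCLM_apply (A : Matrix n n ℂ) : reTraceCLM n A = A.trace.re := rfl

theorem integral_re_trace {F : Ω → Matrix n n ℂ} (hF : Integrable F P) :
    ∫ ω, (F ω).trace.re ∂P = (∫ ω, F ω ∂P).trace.re := by
  simpa only [reTraceCLM_apply] using (reTraceCLM n).integral_comp_comm hF

theorem _root_.MeasureTheory.Integrable.re_trace {F : Ω → Matrix n n ℂ} (hF : Integrable F P) :
    Integrable (fun ω => (F ω).trace.re) P := by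
  simpa only [reTraceCLM_apply] using (reTraceCLM n).integrable_comp hF

theorem continuous_exp : Continuous (NormedSpace.exp : Matrix n n ℂ → Matrix n n ℂ) :=
  let _ : NormedAlgebra ℚ (Matrix n n ℂ) := NormedAlgebra.restrictScalars ℚ ℝ _
  NormedSpace.exp_continuous

variable [Nonempty n]

theorem integrable_exp_of_bound [IsFiniteMeasure P] {S : Ω → Matrix n n ℂ}
    (hS : AEStronglyMeasurable S P) {c : ℝ} (hc : ∀ᵐ ω ∂P, ‖S ω‖ ≤ c) :
    Integrable (fun ω => NormedSpace.exp (S ω)) P := by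
  refine Integrable.of_bound (continuous_exp.comp_aestronglyMeasurable hS) (Real.exp c) ?_
  filter_upwards [hc] with ω hω
  exact (norm_normedSpace_exp_le _).trans (Real.exp_le_exp.2 hω)

/-- One step of the Ahlswede–Winter recursion, centred so that only the trace of `M` enters. -/
theorem integral_re_trace_exp_add_le [IsProbabilityMeasure P] {S X : Ω → Matrix n n ℂ}
    (hSX : IndepFun S X P) (hS : AEStronglyMeasurable S P) (hX : AEStronglyMeasurable X P)
    {c c' κ : ℝ} (hSc : ∀ᵐ ω ∂P, ‖S ω‖ ≤ c) (hXc : ∀ᵐ ω ∂P, ‖X ω‖ ≤ c')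
    (hSH : ∀ᵐ ω ∂P, (S ω).IsHermitian) (hXH : ∀ᵐ ω ∂P, (X ω).IsHermitian)
    (hS0 : ∫ ω, S ω ∂P = 0) {M : Matrix n n ℂ} (hM : M ≤ 1) (hκ : 0 ≤ κ)
    (hexp : ∫ ω, NormedSpace.exp (X ω) ∂P ≤ 1 + κ • M) :
    (∫ ω, (NormedSpace.exp (S ω + X ω)).trace.re ∂P) - Fintype.card n ≤
      (1 + κ) * ((∫ ω, (NormedSpace.exp (S ω)).trace.re ∂P) - Fintype.card n) +
        κ * M.trace.re := by
  have iS := integrable_exp_of_bound hS hSc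
  have iX := integrable_exp_of_bound hX hXc
  have iS0 : Integrable S P := Integrable.of_bound hS c hSc
  have iSX : Integrable (fun ω => NormedSpace.exp (S ω + X ω)) P := by
    refine integrable_exp_of_bound (hS.add hX) (c := c + c') ?_
    filter_upwards [hSc, hXc] with ω h1 h2 using (norm_add_le _ _).trans (add_le_add h1 h2)
  have hind : IndepFun (fun ω => NormedSpace.exp (S ω)) (fun ω => NormedSpace.exp (X ω)) P :=
    hSX.comp continuous_exp.measurable continuous_exp.measurable
  have iprod : Integrable (fun ω => NormedSpace.exp (S ω) * NormedSpace.exp (X ω)) P := by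
    refine Integrable.of_bound (iS.1.mul iX.1) (Real.exp c * Real.exp c') ?_
    filter_upwards [hSc, hXc] with ω h1 h2
    refine (norm_mul_le _ _).trans ?_
    gcongr
    · exact (norm_normedSpace_exp_le _).trans (Real.exp_le_exp.2 h1)
    · exact (norm_normedSpace_exp_le _).trans (Real.exp_le_exp.2 h2)
  have hfac : ∫ ω, NormedSpace.exp (S ω) * NormedSpace.exp (X ω) ∂P =
      (∫ ω, NormedSpace.exp (S ω) ∂P) * ∫ ω, NormedSpace.exp (X ω) ∂P :=
    hind.integral_bilin iS iX (ContinuousLinearMap.mul ℝ (Matrix n n ℂ))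
  set A := ∫ ω, NormedSpace.exp (S ω) ∂P with hA
  have hA0 : 0 ≤ A := integral_nonneg_of_ae (hSH.mono fun ω h => h.exp_nonneg)
  -- Centring enters here: `e^S ≥ 1 + S` and `E S = 0`.
  have hA1 : 1 ≤ A := by
    have h : ∫ ω, (1 + S ω) ∂P ≤ A := by
      refine integral_mono_ae ((integrable_const _).add iS0) iS ?_
      filter_upwards [hSH] with ω h using h.one_add_le_exp
    rwa [integral_add (integrable_const _) iS0, hS0, integral_const, probReal_univ, one_smul,
      add_zero] at h
  have hgt : ∫ ω, (NormedSpace.exp (S ω + X ω)).trace.re ∂P ≤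
      (A * ∫ ω, NormedSpace.exp (X ω) ∂P).trace.re := by
    rw [← hfac, ← integral_re_trace iprod]
    refine integral_mono_ae iSX.re_trace iprod.re_trace ?_
    filter_upwards [hSH, hXH] with ω h1 h2 using re_trace_exp_add_le h1 h2
  have h1 := hgt.trans (re_trace_mul_le_mul_left hA0 hexp)
  -- Splitting `tr (A M) = tr ((A - 1) M) + tr M`, only the excess `A - 1` is estimated through `M ≤
  -- 1`; the remainder keeps `tr M`.
  have h2 := re_trace_mul_le_mul_left (sub_nonneg.2 hA1) hM
  rw [integral_re_trace iS, ← hA]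
  simp only [mul_add, mul_one, mul_smul_comm, trace_add, trace_smul, sub_mul, trace_sub,
    Complex.add_re, Complex.sub_re, one_mul, Complex.real_smul, Complex.re_ofReal_mul, trace_one,
    Complex.natCast_re] at h1 h2
  nlinarith

variable {ι : Type*}

theorem integral_re_trace_exp_sum_le [IsProbabilityMeasure P] {X : ι → Ω → Matrix n n ℂ}
    (hindep : iIndepFun X P) (hX : ∀ i, AEMeasurable (X i) P)
    {c κ : ℝ} (hXc : ∀ i, ∀ᵐ ω ∂P, ‖X i ω‖ ≤ c) (hXH : ∀ i, ∀ᵐ ω ∂P, (X i ω).IsHermitian)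
    (hX0 : ∀ i, ∫ ω, X i ω ∂P = 0) {M : Matrix n n ℂ} (hM : M ≤ 1) (hκ : 0 ≤ κ)
    (hexp : ∀ i, ∫ ω, NormedSpace.exp (X i ω) ∂P ≤ 1 + κ • M) (s : Finset ι) :
    (∫ ω, (NormedSpace.exp (∑ i ∈ s, X i ω)).trace.re ∂P) - Fintype.card n ≤
      M.trace.re * ((1 + κ) ^ s.card - 1) := by
  classical
  induction s using Finset.induction_on with
  | empty => simp [NormedSpace.exp_zero]
  | insert a s ha ih =>
    have iX : ∀ i, Integrable (X i) P := fun i =>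
      Integrable.of_bound (hX i).aestronglyMeasurable c (hXc i)
    have hind : IndepFun (fun ω => ∑ i ∈ s, X i ω) (X a) P := by
      have := hindep.indepFun_finsetSum_of_notMem₀ hX ha
      rwa [show (∑ j ∈ s, X j) = fun ω => ∑ i ∈ s, X i ω by ext1 ω; simp] at this
    have hsm : AEStronglyMeasurable (fun ω => ∑ i ∈ s, X i ω) P :=
      Finset.aestronglyMeasurable_fun_sum s fun i _ => (iX i).1
    have hall : ∀ᵐ ω ∂P, ∀ i ∈ s, ‖X i ω‖ ≤ c :=
      (ae_ball_iff s.countable_toSet).2 fun i _ => hXc i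
    have hallH : ∀ᵐ ω ∂P, ∀ i ∈ s, (X i ω).IsHermitian :=
      (ae_ball_iff s.countable_toSet).2 fun i _ => hXH i
    have step := integral_re_trace_exp_add_le hind hsm (iX a).1 (c := s.card * c) (c' := c)
      (by
        filter_upwards [hall] with ω h
        refine (norm_sum_le_of_le s h).trans ?_
        simp)
      (hXc a)
      (by
        filter_upwards [hallH] with ω h
        exact isSelfAdjoint_sum s h)
      (hXH a) (by rw [integral_finsetSum s fun i _ => iX i]; simp [hX0]) hM hκ (hexp a)
    have e : ∀ ω, ∑ i ∈ insert a s, X i ω = ∑ i ∈ s, X i ω + X a ω := fun ω => by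
      rw [Finset.sum_insert ha, add_comm]
    simp only [e]
    refine step.trans ?_
    rw [Finset.card_insert_of_notMem ha, pow_succ]
    nlinarith [mul_le_mul_of_nonneg_left ih (by linarith : 0 ≤ 1 + κ)]

/-- A one-sided matrix Bernstein-type tail bound in terms of the intrinsic dimension. -/
theorem measureReal_not_sum_le [Fintype ι] [IsProbabilityMeasure P] {X : ι → Ω → Matrix n n ℂ}
    (hindep : iIndepFun X P) (hX : ∀ i, AEMeasurable (X i) P)
    {c κ : ℝ} (hXc : ∀ i, ∀ᵐ ω ∂P, ‖X i ω‖ ≤ c) (hXH : ∀ i, ∀ᵐ ω ∂P, (X i ω).IsHermitian)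
    (hX0 : ∀ i, ∫ ω, X i ω ∂P = 0) {M : Matrix n n ℂ} (hM : M ≤ 1) (hκ : 0 ≤ κ)
    (hexp : ∀ i, ∫ ω, NormedSpace.exp (X i ω) ∂P ≤ 1 + κ • M) {t : ℝ} (ht : 0 ≤ t) :
    (Real.exp t - t - 1) * P.real {ω | ¬ ∑ i, X i ω ≤ t • 1} ≤
      M.trace.re * ((1 + κ) ^ Fintype.card ι - 1) := by
  have iX : ∀ i, Integrable (X i) P := fun i =>
    Integrable.of_bound (hX i).aestronglyMeasurable c (hXc i)
  have iS : Integrable (fun ω => ∑ i, X i ω) P := integrable_finsetSum _ fun i _ => iX i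
  have hH : ∀ᵐ ω ∂P, (∑ i, X i ω).IsHermitian := by
    filter_upwards [ae_all_iff.2 hXH] with ω h
    exact isSelfAdjoint_sum _ fun i _ => h i
  have iE : Integrable (fun ω => NormedSpace.exp (∑ i, X i ω)) P := by
    refine integrable_exp_of_bound iS.1 (c := Fintype.card ι * c) ?_
    filter_upwards [ae_all_iff.2 hXc] with ω h
    refine (norm_sum_le_of_le _ fun i _ => h i).trans ?_
    simp
  have iF : Integrable (fun ω => NormedSpace.exp (∑ i, X i ω) - ∑ i, X i ω - 1) P :=
    (iE.sub iS).sub (integrable_const (1 : Matrix n n ℂ))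
  have hF0 : ∀ᵐ ω ∂P, 0 ≤ (NormedSpace.exp (∑ i, X i ω) - ∑ i, X i ω - 1).trace.re := by
    filter_upwards [hH] with ω h
    have := re_trace_mono h.one_add_le_exp
    simp only [trace_sub, trace_add, Complex.sub_re, Complex.add_re] at this ⊢
    linarith
  have hmarkov := mul_meas_ge_le_integral_of_nonneg hF0 iF.re_trace (Real.exp t - t - 1)
  have hle : P.real {ω | ¬ ∑ i, X i ω ≤ t • 1} ≤ P.real {ω | Real.exp t - t - 1 ≤
      (NormedSpace.exp (∑ i, X i ω) - ∑ i, X i ω - 1).trace.re} := by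
    refine ENNReal.toReal_mono (measure_ne_top _ _) (measure_mono_ae ?_)
    filter_upwards [hH] with ω h hω using h.re_trace_exp_sub_ge ht hω
  refine (mul_le_mul_of_nonneg_left hle (Real.exp_sub_one_sub_id_nonneg t)).trans
    (hmarkov.trans ?_)
  have := integral_re_trace_exp_sum_le hindep hX hXc hXH hX0 hM hκ hexp Finset.univ
  rw [integral_re_trace iE] at this
  refine le_trans (le_of_eq ?_) this
  refine (integral_re_trace iF).trans ?_
  have hS0 : ∫ ω, ∑ i, X i ω ∂P = 0 := by
    rw [integral_finsetSum _ fun i _ => iX i]; simp [hX0]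
  have iES : Integrable (fun ω => NormedSpace.exp (∑ i, X i ω) - ∑ i, X i ω) P := iE.sub iS
  -- The linear term has mean zero, so subtracting it leaves the expected trace unchanged.
  rw [integral_sub iES (integrable_const _), integral_sub iE iS, hS0]
  simp [trace_sub]

end RandomMatrix

end Matrix

/-! ### Numerical constants of the tail bound -/

theorem Real.bernstein_exponent_le {Δ : ℝ} (hΔ : 0 < Δ) :
    Δ ^ 2 / 2 / (1 + 2 * Δ / 3) ≤ (1 + Δ) * Real.log (1 + Δ) - Δ := by
  have h := Real.le_log_one_add_of_nonneg hΔ.le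
  have h1 : (1 + Δ) * (2 * Δ / (Δ + 2)) ≤ (1 + Δ) * Real.log (1 + Δ) := by gcongr
  refine le_trans ?_ (sub_le_sub_right h1 Δ)
  rw [show (1 + Δ) * (2 * Δ / (Δ + 2)) - Δ = Δ ^ 2 / 2 / (1 + Δ / 2) by field_simp; ring]
  exact div_le_div_of_nonneg_left (by positivity) (by positivity) (by linarith)

theorem Real.exp_div_eight_le {t : ℝ} (ht : 1 ≤ t) :
    Real.exp t / 8 ≤ Real.exp t - t - 1 := by
  have h1 : Real.exp t = Real.exp 1 * Real.exp (t - 1) := by rw [← Real.exp_add]; congr 1; ring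
  have h2 := Real.add_one_le_exp (t - 1)
  have h3 := Real.exp_one_gt_d9
  nlinarith

/-- With `t = s R Δ`, the exponents differ by `s ((1 + Δ) R - Δ) ≥ log (16 d / γ)`, so the right
side is at most `e^t γ / 16`. Replacing `e^t - t - 1` by `e^t / 8` gives `γ / 2`: hence `16 = 2 ·
8`. -/
theorem ChristoffelSampling.tail_le_half {d γ Δ s p : ℝ} (hd : 1 / 2 ≤ d) (hγ : 0 < γ)
    (hγ1 : γ < 1) (hΔ : 0 < Δ)
    (hs : ChristoffelSampling.cDelta Δ * Real.log (16 * d / γ) ≤ s) (hp : 0 ≤ p)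
    (h : (Real.exp (s * (Real.log (1 + Δ) * Δ)) - s * (Real.log (1 + Δ) * Δ) - 1) * p ≤
      d * Real.exp (s * (Δ - Real.log (1 + Δ)))) : p ≤ γ / 2 := by
  set l := Real.log (16 * d / γ) with hl
  set R := Real.log (1 + Δ) with hR
  -- Here `d ≥ 1/2` gives `16 d / γ ≥ 8 ≥ e`; this later yields `t ≥ 1`, as `Real.exp_div_eight_le`
  -- requires.
  have hl1 : 1 ≤ l := by
    rw [hl, Real.le_log_iff_exp_le (by positivity)]
    have : Real.exp 1 ≤ 8 := by linarith [Real.exp_one_lt_d9]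
    refine this.trans ?_
    rw [le_div_iff₀ hγ]
    linarith
  have hc : 0 < Δ ^ 2 / 2 / (1 + 2 * Δ / 3) := by positivity
  have hcs : l ≤ s * (Δ ^ 2 / 2 / (1 + 2 * Δ / 3)) := by
    calc l = (ChristoffelSampling.cDelta Δ * l) * (Δ ^ 2 / 2 / (1 + 2 * Δ / 3)) := by
          unfold ChristoffelSampling.cDelta; field_simp
      _ ≤ _ := by gcongr
  have hs0 : 0 < s := by
    by_contra! h0
    nlinarith
  have hexp : l ≤ s * ((1 + Δ) * R - Δ) :=
    hcs.trans (mul_le_mul_of_nonneg_left (Real.bernstein_exponent_le hΔ) hs0.le)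
  have hRΔ : R ≤ Δ := by
    have := Real.log_le_sub_one_of_pos (show 0 < 1 + Δ by linarith)
    linarith
  set t := s * (R * Δ) with ht
  have htl : l + s * (Δ - R) ≤ t := by linarith
  have ht1 : 1 ≤ t := by
    have : 0 ≤ s * (Δ - R) := mul_nonneg hs0.le (sub_nonneg.2 hRΔ)
    linarith
  have h8 := mul_le_mul_of_nonneg_right (Real.exp_div_eight_le ht1) hp
  have h9 : d * Real.exp (s * (Δ - R)) ≤ Real.exp t * (γ / 16) := by
    have : Real.exp (s * (Δ - R)) ≤ Real.exp t * (γ / (16 * d)) := by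
      have e : γ / (16 * d) = Real.exp (-l) := by
        rw [Real.exp_neg, hl, Real.exp_log (by positivity), inv_div]
      rw [e, ← Real.exp_add]
      exact Real.exp_le_exp.2 (by linarith)
    calc d * Real.exp (s * (Δ - R)) ≤ d * (Real.exp t * (γ / (16 * d))) := by gcongr
      _ = _ := by field_simp
  have h10 : Real.exp t * p ≤ Real.exp t * (γ / 2) := by linarith
  exact le_of_mul_le_mul_left h10 (Real.exp_pos t)

namespace Matrix

/-! ### Tail bound for bounded positive semidefinite summands -/

section RandomMatrix

open scoped Matrix.Norms.L2Operator

variable {n : Type*} [Fintype n] [DecidableEq n]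

theorem mul_self_le_smul {Z : Matrix n n ℂ} {L : ℝ} (h0 : 0 ≤ Z) (hL : Z ≤ L • 1) :
    Z * Z ≤ L • Z := by
  have hZ : IsSelfAdjoint Z := (nonneg_iff_posSemidef.1 h0).isHermitian
  have u1 := (le_algebraMap_iff_spectrum_le hZ).1
    (hL.trans_eq (Algebra.algebraMap_eq_smul_one L).symm)
  have u0 : ∀ x ∈ spectrum ℝ Z, 0 ≤ x := fun x hx => spectrum_nonneg_of_nonneg h0 hx
  rw [← pow_two, ← cfc_pow_id (R := ℝ) Z 2]
  conv_rhs => rw [← cfc_id' ℝ Z, ← cfc_const_mul L (fun x : ℝ => x) Z]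
  exact cfc_mono fun x hx => by
    rw [pow_two]; exact mul_le_mul_of_nonneg_right (u1 x hx) (u0 x hx)

theorem le_re_trace_smul_one {A : Matrix n n ℂ} (hA : 0 ≤ A) : A ≤ A.trace.re • 1 := by
  have hP := nonneg_iff_posSemidef.1 hA
  have hS : IsSelfAdjoint A := hP.isHermitian
  rw [← Algebra.algebraMap_eq_smul_one, le_algebraMap_iff_spectrum_le hS,
    hP.isHermitian.spectrum_real_eq_range_eigenvalues]
  rintro _ ⟨i, rfl⟩
  rw [hP.isHermitian.trace_eq_sum_eigenvalues]
  simpa using Finset.single_le_sum (fun i _ => hP.eigenvalues_nonneg i) (Finset.mem_univ i)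

theorem norm_le_of_nonneg_of_le {A : Matrix n n ℂ} {L : ℝ} (hL : 0 ≤ L) (h0 : 0 ≤ A)
    (h : A ≤ L • 1) : ‖A‖ ≤ L :=
  (CStarAlgebra.norm_le_iff_le_algebraMap A hL h0).2
    (h.trans_eq (Algebra.algebraMap_eq_smul_one L).symm)

variable [Nonempty n] {Ω : Type*} [MeasurableSpace Ω] {P : Measure Ω} [IsProbabilityMeasure P]

/-- Bernstein's variance estimate: `E (Z - M)² ≤ L M - M² ≤ L M`, because `Z² ≤ L Z`. The quadratic
bound on `exp` is even in its coefficient, so both signs `σ` give the same constant. -/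
theorem integral_exp_centered_le {Z : Ω → Matrix n n ℂ} (hZ : AEMeasurable Z P) {L R σ : ℝ}
    (hL : 0 < L) (hR : 0 < R) (hσ : σ ^ 2 = 1) (h0 : ∀ᵐ ω ∂P, 0 ≤ Z ω)
    (hZL : ∀ᵐ ω ∂P, Z ω ≤ L • 1) {M : Matrix n n ℂ} (hM : ∫ ω, Z ω ∂P = M) :
    ∫ ω, NormedSpace.exp ((σ * (R / L)) • (Z ω - M)) ∂P ≤
      1 + ((Real.exp R - R - 1) / L) • M := by
  have hnorm : ∀ᵐ ω ∂P, ‖Z ω‖ ≤ L := by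
    filter_upwards [h0, hZL] with ω h1 h2 using norm_le_of_nonneg_of_le hL.le h1 h2
  have iZ : Integrable Z P := Integrable.of_bound hZ.aestronglyMeasurable L hnorm
  have hM0 : 0 ≤ M := hM ▸ integral_nonneg_of_ae h0
  have hML : M ≤ L • 1 := by
    have := integral_mono_ae iZ (integrable_const (L • (1 : Matrix n n ℂ))) hZL
    simpa [hM] using this
  have hZH : ∀ᵐ ω ∂P, (Z ω).IsHermitian :=
    h0.mono fun ω h => (nonneg_iff_posSemidef.1 h).isHermitian
  have hMH : M.IsHermitian := (nonneg_iff_posSemidef.1 hM0).isHermitian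
  set g : ℝ := (Real.exp R - R - 1) / R ^ 2 with hg
  have hg0 : 0 ≤ g := div_nonneg (Real.exp_sub_one_sub_id_nonneg R) (sq_nonneg R)
  set a : ℝ := σ * (R / L) with ha
  have hab : |a| = R / L := by
    have : |σ| = 1 := by rw [← sq_abs] at hσ; nlinarith [abs_nonneg σ]
    rw [ha, abs_mul, this, one_mul, abs_of_pos (by positivity)]
  -- Both `Z` and `M` lie between `0` and `L`, so the deviation is bounded by `L` rather than `2L`.
  have hlow : ∀ᵐ ω ∂P, -(L • (1 : Matrix n n ℂ)) ≤ Z ω - M ∧ Z ω - M ≤ L • 1 := by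
    filter_upwards [h0, hZL] with ω h1 h2
    exact ⟨by rw [neg_le_iff_add_nonneg, sub_add, sub_nonneg];
              exact (sub_nonpos.2 hML).trans h1, (sub_le_self _ hM0).trans h2⟩
  have hsm : ∀ (b : ℝ), |b| = R / L → ∀ Y : Matrix n n ℂ, -(L • 1) ≤ Y → Y ≤ L • 1 →
      b • Y ≤ R • 1 := by
    intro b hb Y h1 h2
    have e : R • (1 : Matrix n n ℂ) = |b| • L • 1 := by
      rw [hb, smul_smul, div_mul_cancel₀ _ hL.ne']
    rw [e]
    rcases abs_cases b with ⟨hb', hb0⟩ | ⟨hb', hb0⟩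
    · rw [hb']; exact smul_le_smul_of_nonneg_left h2 hb0
    · rw [hb', ← neg_smul_neg b Y]
      exact smul_le_smul_of_nonneg_left (neg_le.1 h1) (by linarith)
  have iExp : Integrable (fun ω => NormedSpace.exp (a • (Z ω - M))) P := by
    refine integrable_exp_of_bound (c := |a| * (L + ‖M‖))
      ((iZ.1.sub aestronglyMeasurable_const).const_smul a) ?_
    filter_upwards [hnorm] with ω h
    rw [norm_smul, Real.norm_eq_abs]
    gcongr
    exact (norm_sub_le _ _).trans (by gcongr)
  have iC : Integrable (fun ω => a • (Z ω - M)) P := (iZ.sub (integrable_const M)).smul a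
  have iQ : Integrable (fun ω => (g * a ^ 2) • (L • Z ω - Z ω * M - M * Z ω + M * M)) P := by
    have := (((iZ.smul L).sub (iZ.mul_const M)).sub (iZ.const_mul M)).add
      (integrable_const (M * M))
    exact this.smul (g * a ^ 2)
  have hpt : ∀ᵐ ω ∂P, NormedSpace.exp (a • (Z ω - M)) ≤
      1 + a • (Z ω - M) + (g * a ^ 2) • (L • Z ω - Z ω * M - M * Z ω + M * M) := by
    filter_upwards [hlow, hZH, h0, hZL] with ω h1 h2 h3 h4
    have hH : (a • (Z ω - M)).IsHermitian := by
      simp [IsHermitian, conjTranspose_smul, h2.eq, hMH.eq]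
    refine (hH.exp_le_of_le hR (hsm a hab _ h1.1 h1.2) ?_).trans ?_
    · rw [← neg_smul]
      exact hsm (-a) (by rw [abs_neg, hab]) _ h1.1 h1.2
    · gcongr
      rw [smul_mul_smul_comm, smul_smul, ← pow_two a]
      refine smul_le_smul_of_nonneg_left ?_ (by positivity)
      have : (Z ω - M) * (Z ω - M) = Z ω * Z ω - Z ω * M - M * Z ω + M * M := by noncomm_ring
      rw [this]
      gcongr
      exact mul_self_le_smul h3 h4
  have hint := integral_mono_ae iExp (((integrable_const 1).add iC).add iQ) hpt
  have i1 : Integrable (fun ω => L • Z ω) P := iZ.smul L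
  have i2 : Integrable (fun ω => L • Z ω - Z ω * M) P := i1.sub (iZ.mul_const M)
  have i3 : Integrable (fun ω => L • Z ω - Z ω * M - M * Z ω) P := i2.sub (iZ.const_mul M)
  have e1 : ∫ ω, a • (Z ω - M) ∂P = 0 := by
    rw [integral_smul, integral_sub iZ (integrable_const M), hM]; simp
  have e2 : ∫ ω, (g * a ^ 2) • (L • Z ω - Z ω * M - M * Z ω + M * M) ∂P =
      (g * a ^ 2) • (L • M - M * M) := by
    have c1 : ∫ ω, Z ω * M ∂P = M * M := by
      have h := ((ContinuousLinearMap.mul ℝ (Matrix n n ℂ)).flip M).integral_comp_comm iZ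
      simpa [hM] using h
    have c2 : ∫ ω, M * Z ω ∂P = M * M := by
      have h := (ContinuousLinearMap.mul ℝ (Matrix n n ℂ) M).integral_comp_comm iZ
      simpa [hM] using h
    rw [integral_smul, integral_add i3 (integrable_const _), integral_sub i2 (iZ.const_mul M),
      integral_sub i1 (iZ.mul_const M), integral_smul, c1, c2, hM]
    simp
  have e3 : ∫ ω, (1 + a • (Z ω - M) + (g * a ^ 2) • (L • Z ω - Z ω * M - M * Z ω + M * M)) ∂P =
      1 + (g * a ^ 2) • (L • M - M * M) := by
    have i4 : Integrable (fun ω => 1 + a • (Z ω - M)) P := (integrable_const 1).add iC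
    rw [integral_add i4 iQ, integral_add (integrable_const _) iC, e1, e2]
    simp
  refine (hint.trans_eq e3).trans ?_
  have hMM : 0 ≤ M * M := by
    have := posSemidef_conjTranspose_mul_self M
    rw [hMH.eq] at this
    exact nonneg_iff_posSemidef.2 this
  have e4 : ((Real.exp R - R - 1) / L) • M = (g * a ^ 2) • L • M := by
    rw [smul_smul, hg, ha, mul_pow, hσ]
    congr 1
    field_simp
  rw [e4]
  gcongr
  exact sub_le_self _ hMM

/-- The threshold `mΔ`, rescaled by `R / L`, becomes `t = s R Δ`; the growth factor is simplified by
`1 + κ ≤ e^κ`. The parameter `R` remains free for optimisation. -/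
theorem measureReal_not_sum_centered_le {ι : Type*} [Fintype ι] {Z : ι → Ω → Matrix n n ℂ}
    (hindep : iIndepFun Z P) (hZ : ∀ i, AEMeasurable (Z i) P) {L R σ Δ : ℝ}
    (hL : 0 < L) (hR : 0 < R) (hσ : σ ^ 2 = 1) (hΔ : 0 ≤ Δ) (h0 : ∀ i, ∀ᵐ ω ∂P, 0 ≤ Z i ω)
    (hZL : ∀ i, ∀ᵐ ω ∂P, Z i ω ≤ L • 1) {M : Matrix n n ℂ} (hM : ∀ i, ∫ ω, Z i ω ∂P = M)
    (hM0 : 0 ≤ M) (hM1 : M ≤ 1) {s : ℝ} (hs : s = Fintype.card ι / L) :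
    (Real.exp (s * (R * Δ)) - s * (R * Δ) - 1) *
        P.real {ω | ¬ σ • ∑ i, (Z i ω - M) ≤ (Fintype.card ι * Δ) • 1} ≤
      M.trace.re * Real.exp (s * (Real.exp R - R - 1)) := by
  have hnorm : ∀ i, ∀ᵐ ω ∂P, ‖Z i ω‖ ≤ L := fun i => by
    filter_upwards [h0 i, hZL i] with ω h1 h2 using norm_le_of_nonneg_of_le hL.le h1 h2
  have iZ : ∀ i, Integrable (Z i) P := fun i =>
    Integrable.of_bound (hZ i).aestronglyMeasurable L (hnorm i)
  have hMH : M.IsHermitian := (nonneg_iff_posSemidef.1 hM0).isHermitian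
  have hcont : Continuous fun A : Matrix n n ℂ => (σ * (R / L)) • (A - M) := by fun_prop
  have hκ : 0 ≤ (Real.exp R - R - 1) / L :=
    div_nonneg (Real.exp_sub_one_sub_id_nonneg R) hL.le
  have key := measureReal_not_sum_le (P := P) (X := fun i ω => (σ * (R / L)) • (Z i ω - M))
    (c := |σ * (R / L)| * (L + ‖M‖)) (κ := (Real.exp R - R - 1) / L) (M := M)
    (t := s * (R * Δ))
    (hindep.comp (fun _ A => (σ * (R / L)) • (A - M)) fun _ => hcont.measurable)
    (fun i => hcont.measurable.comp_aemeasurable (hZ i))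
    (fun i => by
      filter_upwards [hnorm i] with ω h
      rw [norm_smul, Real.norm_eq_abs]
      gcongr
      exact (norm_sub_le _ _).trans (by gcongr))
    (fun i => by
      filter_upwards [h0 i] with ω h
      simp [IsHermitian, conjTranspose_smul, (nonneg_iff_posSemidef.1 h).isHermitian.eq, hMH.eq])
    (fun i => by
      rw [integral_smul, integral_sub (iZ i) (integrable_const M), hM]; simp)
    hM1 hκ
    (fun i => integral_exp_centered_le (hZ i) hL hR hσ (h0 i) (hZL i) (hM i))
    (by rw [hs]; positivity)
  have hset : {ω | ¬ ∑ i, (σ * (R / L)) • (Z i ω - M) ≤ (s * (R * Δ)) • 1} =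
      {ω | ¬ σ • ∑ i, (Z i ω - M) ≤ (Fintype.card ι * Δ) • 1} := by
    ext ω
    have hRL : 0 < R / L := by positivity
    rw [Set.mem_ofPred_eq, Set.mem_ofPred_eq, ← Finset.smul_sum, mul_comm σ, mul_smul,
      show s * (R * Δ) = R / L * (Fintype.card ι * Δ) by rw [hs]; ring, mul_smul,
      smul_le_smul_iff_of_pos_left hRL]
  rw [hset] at key
  refine key.trans (mul_le_mul_of_nonneg_left ?_ ?_)
  · have h1 : (1 + (Real.exp R - R - 1) / L) ^ Fintype.card ι ≤
        Real.exp ((Real.exp R - R - 1) / L) ^ Fintype.card ι := by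
      gcongr
      linarith [Real.add_one_le_exp ((Real.exp R - R - 1) / L)]
    rw [← Real.exp_nat_mul] at h1
    rw [show s * (Real.exp R - R - 1) = Fintype.card ι * ((Real.exp R - R - 1) / L) by
      rw [hs]; ring]
    linarith
  · simpa using re_trace_mono hM0

end RandomMatrix

end Matrix

end

/-! ### Gram matrices, whitening and the sampling measure -/

namespace ChristoffelSampling

section

open Matrix
open scoped Matrix.Norms.L2Operator ComplexOrder

variable {α : Type*} [MeasurableSpace α] {n : ℕ} {ρ : Measure α} {φ : Fin n → α → ℂ}

/-- The transpose appears because the inner product is conjugate-linear in its first argument. -/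
theorem gram_eq_transpose_gram (hφ : ∀ i, MemLp (φ i) 2 ρ) :
    gram ρ φ = (Matrix.gram ℂ fun i => (hφ i).toLp (φ i))ᵀ := by
  ext i j
  rw [transpose_apply, Matrix.gram_apply, L2.inner_def]
  refine integral_congr_ae ?_
  filter_upwards [(hφ i).coeFn_toLp, (hφ j).coeFn_toLp] with x h1 h2
  simp [h1, h2]

theorem gram_posSemidef (hφ : ∀ i, MemLp (φ i) 2 ρ) : (gram ρ φ).PosSemidef := by
  rw [gram_eq_transpose_gram hφ]
  exact (posSemidef_gram ℂ _).transpose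

theorem gram_posDef (hφ : ∀ i, MemLp (φ i) 2 ρ)
    (hbasis : LinearIndependent ℂ fun i => (hφ i).toLp (φ i)) : (gram ρ φ).PosDef := by
  rw [gram_eq_transpose_gram hφ]
  exact (posDef_gram_of_linearIndependent hbasis).transpose

theorem regularized_posDef (hφ : ∀ i, MemLp (φ i) 2 ρ)
    (hbasis : LinearIndependent ℂ fun i => (hφ i).toLp (φ i)) (ε : ℝ) :
    (regularized ε (gram ρ φ)).PosDef := by
  refine (gram_posDef hφ hbasis).add_posSemidef ?_
  rw [← nonneg_iff_posSemidef]
  exact smul_nonneg (sq_nonneg ε) zero_le_one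

theorem gram_eigenvalues_pos (hφ : ∀ i, MemLp (φ i) 2 ρ)
    (hbasis : LinearIndependent ℂ fun i => (hφ i).toLp (φ i)) (i : Fin n) :
    0 < (gram_isHermitian ρ φ).eigenvalues i := by
  exact (gram_posDef hφ hbasis).eigenvalues_pos i

theorem numDim_eq_re_trace (hφ : ∀ i, MemLp (φ i) 2 ρ)
    (hbasis : LinearIndependent ℂ fun i => (hφ i).toLp (φ i)) (ε : ℝ) :
    numDim ρ φ ε = (gram ρ φ * (regularized ε (gram ρ φ))⁻¹).trace.re := by
  set G := gram ρ φ with hGdef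
  have hH : G.IsHermitian := gram_isHermitian ρ φ
  have hS : IsSelfAdjoint G := hH
  have hc : ∀ f : ℝ → ℝ, ContinuousOn f (spectrum ℝ G) := fun f =>
    (finite_real_spectrum (A := G)).continuousOn f
  have e1 : cfc (fun x : ℝ => x + ε ^ 2) G = regularized ε G := by
    rw [cfc_add (R := ℝ) (a := G) (fun x => x) (fun _ => ε ^ 2), cfc_id' ℝ G,
      cfc_const (ε ^ 2) G, Algebra.algebraMap_eq_smul_one, regularized]
  have e2 : cfc (fun x : ℝ => x / (x + ε ^ 2)) G * regularized ε G = G := by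
    rw [← e1, ← cfc_mul (fun x : ℝ => x / (x + ε ^ 2)) (fun x => x + ε ^ 2) G (hc _) (hc _)]
    conv_rhs => rw [← cfc_id' ℝ G]
    refine cfc_congr fun x hx => ?_
    rw [hH.spectrum_real_eq_range_eigenvalues] at hx
    obtain ⟨i, rfl⟩ := hx
    have := gram_eigenvalues_pos hφ hbasis i
    exact div_mul_cancel₀ _ (by positivity)
  have hdet := (isUnit_iff_isUnit_det _).1 (regularized_posDef hφ hbasis ε).isUnit
  have e3 : G * (regularized ε G)⁻¹ = cfc (fun x : ℝ => x / (x + ε ^ 2)) G := by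
    have h := mul_nonsing_inv_cancel_right _ (cfc (fun x : ℝ => x / (x + ε ^ 2)) G) hdet
    rwa [e2] at h
  rw [e3, hH.re_trace_cfc]
  rfl

/-- The largest eigenvalue is at least `‖G‖ ≥ ε²`, so its term alone contributes `1/2`. -/
theorem half_le_numDim (hφ : ∀ i, MemLp (φ i) 2 ρ)
    (hbasis : LinearIndependent ℂ fun i => (hφ i).toLp (φ i)) [Nonempty (Fin n)] {ε : ℝ}
    (hG : ε ^ 2 ≤ ‖Matrix.toEuclideanCLM (n := Fin n) (𝕜 := ℂ) (gram ρ φ)‖) :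
    1 / 2 ≤ numDim ρ φ ε := by
  have hH := gram_isHermitian ρ φ
  have hS : IsSelfAdjoint (gram ρ φ) := hH
  have hpos := gram_eigenvalues_pos hφ hbasis
  obtain ⟨i, hi⟩ := Finite.exists_max hH.eigenvalues
  have hle : gram ρ φ ≤ hH.eigenvalues i • 1 := by
    rw [← Algebra.algebraMap_eq_smul_one, le_algebraMap_iff_spectrum_le hS,
      hH.spectrum_real_eq_range_eigenvalues]
    rintro _ ⟨j, rfl⟩
    exact hi j
  have hnorm := norm_le_of_nonneg_of_le (hpos i).le
    (nonneg_iff_posSemidef.2 (gram_posSemidef hφ)) hle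
  rw [cstar_norm_def] at hnorm
  have h1 : ε ^ 2 ≤ hH.eigenvalues i := hG.trans hnorm
  have h2 : 1 / 2 ≤ hH.eigenvalues i / (hH.eigenvalues i + ε ^ 2) := by
    rw [div_le_div_iff₀ two_pos (by have := hpos i; positivity)]
    linarith
  refine h2.trans (Finset.single_le_sum
    (f := fun i => hH.eigenvalues i / (hH.eigenvalues i + ε ^ 2)) (fun j _ => ?_)
    (Finset.mem_univ i))
  have := hpos j
  positivity

/-- The weighted rank-one matrix `w_u(x) φ(x) φ(x)^*`. -/
noncomputable def weightedOuter (ρ : Measure α) (φ : Fin n → α → ℂ) (u : α → ℝ) (x : α) :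
    Matrix (Fin n) (Fin n) ℂ :=
  weight ρ u x • vecMulVec (fun i => φ i x) (star fun i => φ i x)

theorem discreteGram_eq_smul_sum {m : ℕ} (u : α → ℝ) (x : Fin m → α) :
    discreteGram ρ φ u x = (m : ℝ)⁻¹ • ∑ k, weightedOuter ρ φ u (x k) := by
  ext i j
  simp [discreteGram, weightedOuter, vecMulVec_apply, Matrix.sum_apply, Finset.mul_sum]
  refine Finset.sum_congr rfl fun k _ => ?_
  ring

theorem integral_matrix_apply {F : α → Matrix (Fin n) (Fin n) ℂ} {μ : Measure α}
    (hF : Integrable F μ) (i j : Fin n) : (∫ x, F x ∂μ) i j = ∫ x, F x i j ∂μ :=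
  ((LinearMap.toContinuousLinearMap (entryLinearMap ℝ ℂ i j)).integral_comp_comm hF).symm

theorem integrable_matrix {F : α → Matrix (Fin n) (Fin n) ℂ} {μ : Measure α}
    (hF : ∀ i j, Integrable (fun x => F x i j) μ) : Integrable F μ := by
  have e : F = fun x => ∑ i, ∑ j, F x i j • single i j (1 : ℂ) := by
    ext1 x
    conv_lhs => rw [matrix_eq_sum_single (F x)]
    simp [smul_single]
  rw [e]
  exact integrable_finsetSum _ fun i _ => integrable_finsetSum _ fun j _ => (hF i j).smul_const _

variable {u : α → ℝ}

theorem l1Norm_pos [IsProbabilityMeasure ρ] (hu : Integrable u ρ) (hpos : ∀ x, 0 < u x) :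
    0 < l1Norm ρ u := by
  unfold l1Norm
  rw [integral_pos_iff_support_of_nonneg (fun x => abs_nonneg _) hu.abs]
  have : Function.support (fun x => |u x|) = Set.univ := by
    ext x; simp [(hpos x).ne']
  rw [this]
  simp

/-- The density `u / ‖u‖₁` cancels the weight pointwise, which makes the weighted estimator
unbiased. -/
theorem integrable_weightedOuter_and_integral [IsProbabilityMeasure ρ]
    (hφ : ∀ i, MemLp (φ i) 2 ρ) (hu : Integrable u ρ) (hpos : ∀ x, 0 < u x) :
    Integrable (weightedOuter ρ φ u) (samplingMeasure ρ u) ∧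
      ∫ x, weightedOuter ρ φ u x ∂samplingMeasure ρ u = gram ρ φ := by
  have hL := l1Norm_pos hu hpos
  have hm : AEMeasurable (fun x => ENNReal.ofReal (u x / l1Norm ρ u)) ρ :=
    (hu.1.aemeasurable.div_const _).ennreal_ofReal
  have hlt : ∀ᵐ x ∂ρ, ENNReal.ofReal (u x / l1Norm ρ u) < ⊤ :=
    ae_of_all _ fun x => ENNReal.ofReal_lt_top
  have e : ∀ x, (ENNReal.ofReal (u x / l1Norm ρ u)).toReal • weightedOuter ρ φ u x =
      vecMulVec (fun i => φ i x) (star fun i => φ i x) := fun x => by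
    rw [ENNReal.toReal_ofReal (div_nonneg (hpos x).le hL.le), weightedOuter, smul_smul, weight,
      div_mul_div_cancel₀ hL.ne', div_self (hpos x).ne', one_smul]
  have hint : Integrable (fun x => vecMulVec (fun i => φ i x) (star fun i => φ i x)) ρ := by
    refine integrable_matrix fun i j => ?_
    simp only [vecMulVec_apply, Pi.star_apply]
    exact (hφ i).integrable_mul (hφ j).star
  constructor
  · rw [samplingMeasure, integrable_withDensity_iff_integrable_smul₀' hm hlt]
    simpa only [e] using hint
  · rw [samplingMeasure, integral_withDensity_eq_integral_toReal_smul₀ hm hlt]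
    simp only [e]
    ext i j
    rw [integral_matrix_apply hint]
    rfl

theorem exists_whitening {B : Matrix (Fin n) (Fin n) ℂ} (hB : B.PosDef) :
    ∃ D : Matrix (Fin n) (Fin n) ℂ, IsUnit D ∧ D * B * star D = 1 ∧ B⁻¹ = star D * D := by
  obtain ⟨D, hD⟩ := CStarAlgebra.nonneg_iff_eq_star_mul_self.mp
    (nonneg_iff_posSemidef.2 hB.inv.posSemidef)
  have hu : IsUnit D := by
    have := (isUnit_iff_isUnit_det _).1 hB.inv.isUnit
    rw [hD, det_mul] at this
    exact (isUnit_iff_isUnit_det _).2 (isUnit_of_mul_isUnit_right this)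
  refine ⟨D, hu, ?_, hD⟩
  have h1 : star D * D * B = 1 := by
    rw [← hD, nonsing_inv_mul _ ((isUnit_iff_isUnit_det _).1 hB.isUnit)]
  rw [mul_assoc] at h1
  -- For square matrices the left inverse `D*` of `D B` is also a right inverse, so no Hermitian
  -- square root is needed.
  exact mul_eq_one_comm.1 h1

/-- The trace bounds a positive semidefinite matrix, without loss at rank one, and here it equals
`w_u k_n^ε`. -/
theorem whitened_weightedOuter_le {ε : ℝ} {D : Matrix (Fin n) (Fin n) ℂ}
    (hD : (regularized ε (gram ρ φ))⁻¹ = star D * D) (hL : 0 < l1Norm ρ u)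
    (hpos : ∀ x, 0 < u x) (huk : ∀ x, invChristoffel ρ φ ε x ≤ u x) (x : α) :
    0 ≤ D * weightedOuter ρ φ u x * star D ∧
      D * weightedOuter ρ φ u x * star D ≤ l1Norm ρ u • 1 := by
  have hw : 0 ≤ weight ρ u x := div_nonneg hL.le (hpos x).le
  have h0 : 0 ≤ weightedOuter ρ φ u x :=
    smul_nonneg hw (nonneg_iff_posSemidef.2 (posSemidef_vecMulVec_self_star _))
  have h1 : 0 ≤ D * weightedOuter ρ φ u x * star D :=
    nonneg_iff_posSemidef.2 ((nonneg_iff_posSemidef.1 h0).mul_mul_conjTranspose_same D)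
  refine ⟨h1, (le_re_trace_smul_one h1).trans ?_⟩
  have htr : (D * weightedOuter ρ φ u x * star D).trace.re =
      weight ρ u x * invChristoffel ρ φ ε x := by
    rw [trace_mul_cycle, ← hD, weightedOuter, mul_smul_comm, trace_smul, Complex.real_smul,
      Complex.re_ofReal_mul, mul_vecMulVec, trace_vecMulVec, dotProduct_comm, invChristoffel]
  gcongr
  rw [htr, weight]
  calc l1Norm ρ u / u x * invChristoffel ρ φ ε x ≤ l1Norm ρ u / u x * u x := by
        gcongr
        exact huk x
    _ = l1Norm ρ u := div_mul_cancel₀ _ (hpos x).ne'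

theorem measureReal_tail_le_half [IsProbabilityMeasure ρ] [Nonempty (Fin n)]
    (hφ : ∀ i, MemLp (φ i) 2 ρ)
    (hbasis : LinearIndependent ℂ fun i => (hφ i).toLp (φ i)) {ε : ℝ}
    (hG : ε ^ 2 ≤ ‖Matrix.toEuclideanCLM (n := Fin n) (𝕜 := ℂ) (gram ρ φ)‖)
    (hu : Integrable u ρ) (hpos : ∀ x, 0 < u x) (huk : ∀ x, invChristoffel ρ φ ε x ≤ u x)
    {Δ γ : ℝ} (hΔ : 0 < Δ) (hγ0 : 0 < γ) (hγ1 : γ < 1) {m : ℕ}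
    (hm : cDelta Δ * Real.log (16 * numDim ρ φ ε / γ) * l1Norm ρ u ≤ (m : ℝ))
    {Ω : Type*} [MeasurableSpace Ω] {P : Measure Ω} [IsProbabilityMeasure P]
    {x : Fin m → Ω → α} (hindep : iIndepFun x P)
    (hlaw : ∀ k, HasLaw (x k) (samplingMeasure ρ u) P)
    {D : Matrix (Fin n) (Fin n) ℂ} (hDu : D * regularized ε (gram ρ φ) * star D = 1)
    (hD : (regularized ε (gram ρ φ))⁻¹ = star D * D) {σ : ℝ} (hσ : σ ^ 2 = 1) :
    P.real {ω | ¬ σ • ∑ k, (D * weightedOuter ρ φ u (x k ω) * star D - D * gram ρ φ * star D) ≤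
      (m * Δ) • 1} ≤ γ / 2 := by
  have hL := l1Norm_pos hu hpos
  obtain ⟨iW, hW⟩ := integrable_weightedOuter_and_integral hφ hu hpos
  set M := D * gram ρ φ * star D with hMdef
  set T : Matrix (Fin n) (Fin n) ℂ →L[ℝ] Matrix (Fin n) (Fin n) ℂ :=
    (ContinuousLinearMap.mulLeftRight ℝ (Matrix (Fin n) (Fin n) ℂ) D (star D)) with hT
  have hTm : ∀ k, AEMeasurable (fun y => T (weightedOuter ρ φ u y)) (P.map (x k)) := fun k => by
    rw [(hlaw k).map_eq]
    exact (T.integrable_comp iW).1.aemeasurable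
  have hbd := fun y => whitened_weightedOuter_le hD hL hpos huk y
  have hM0 : 0 ≤ M := nonneg_iff_posSemidef.2
    ((gram_posSemidef hφ).mul_mul_conjTranspose_same D)
  have hM1 : M ≤ 1 := by
    rw [← hDu, hMdef, le_iff, ← sub_mul, ← mul_sub]
    refine PosSemidef.mul_mul_conjTranspose_same (nonneg_iff_posSemidef.1 ?_) D
    rw [regularized, add_sub_cancel_left]
    exact smul_nonneg (sq_nonneg ε) zero_le_one
  have htr : M.trace.re = numDim ρ φ ε := by
    rw [numDim_eq_re_trace hφ hbasis, hMdef, trace_mul_cycle, trace_mul_comm, hD]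
  -- `R = log (1 + Δ)` minimises the exponent `e^R - R - 1 - RΔ`.
  have key := measureReal_not_sum_centered_le (P := P) (L := l1Norm ρ u)
    (R := Real.log (1 + Δ)) (σ := σ) (Δ := Δ) (M := M) (s := m / l1Norm ρ u)
    (Z := fun k ω => T (weightedOuter ρ φ u (x k ω)))
    (hindep.comp₀ (fun _ y => T (weightedOuter ρ φ u y)) (fun k => (hlaw k).aemeasurable) hTm)
    (fun k => (hTm k).comp_aemeasurable (hlaw k).aemeasurable)
    hL (Real.log_pos (by linarith)) hσ hΔ.le
    (fun k => ae_of_all _ fun ω => (hbd (x k ω)).1)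
    (fun k => ae_of_all _ fun ω => (hbd (x k ω)).2)
    (fun k => by
      have h := (hlaw k).integral_comp (T.integrable_comp iW).1
      refine h.trans ((T.integral_comp_comm iW).trans ?_)
      rw [hW]
      rfl)
    hM0 hM1 (by simp)
  rw [htr, Real.exp_log (by linarith), show (1 + Δ - Real.log (1 + Δ) - 1 : ℝ) =
    Δ - Real.log (1 + Δ) by ring, Fintype.card_fin] at key
  exact tail_le_half (half_le_numDim hφ hbasis hG) hγ0 hγ1 hΔ ((le_div_iff₀ hL).2 hm)
    measureReal_nonneg key

theorem whiten_le_iff {D A B : Matrix (Fin n) (Fin n) ℂ} (hD : IsUnit D) :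
    A ≤ B ↔ D * A * star D ≤ D * B * star D := by
  rw [le_iff, le_iff, ← sub_mul, ← mul_sub, IsUnit.posSemidef_star_right_conjugate_iff hD]

end

end ChristoffelSampling

/-! ### The sampling theorem -/

theorem lemma3p1 {d : ℕ} {X : Set (EuclideanSpace ℝ (Fin d))}
    (ρ : Measure X) [IsProbabilityMeasure ρ]
    {n : ℕ} (φ : Fin n → X → ℂ) (hφ : ∀ i, MemLp (φ i) 2 ρ)
    (hbasis : LinearIndependent ℂ fun i => (hφ i).toLp (φ i))
    (ε : ℝ) (hε : 0 ≤ ε)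
    (hG : ε ^ 2 ≤ ‖Matrix.toEuclideanCLM (n := Fin n) (𝕜 := ℂ) (ChristoffelSampling.gram ρ φ)‖)
    (hk : ∀ x, 0 < ChristoffelSampling.invChristoffel ρ φ ε x)
    (u : X → ℝ) (hu : Integrable u ρ)
    (huk : ∀ x, ChristoffelSampling.invChristoffel ρ φ ε x ≤ u x)
    (Δ γ : ℝ) (hΔ : 0 < Δ) (hγ0 : 0 < γ) (hγ1 : γ < 1)
    (m : ℕ)
    (hm : ChristoffelSampling.cDelta Δ *
        Real.log (16 * ChristoffelSampling.numDim ρ φ ε / γ) *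
        ChristoffelSampling.l1Norm ρ u ≤ (m : ℝ))
    {Ω : Type*} [MeasurableSpace Ω] (P : Measure Ω) [IsProbabilityMeasure P]
    (x : Fin m → Ω → X) (hindep : iIndepFun x P)
    (hlaw : ∀ k, HasLaw (x k) (ChristoffelSampling.samplingMeasure ρ u) P) :
    1 - γ ≤ P.real {ω |
      (1 - Δ) • ChristoffelSampling.regularized ε (ChristoffelSampling.gram ρ φ) ≤
          ChristoffelSampling.regularized ε
            (ChristoffelSampling.discreteGram ρ φ u fun k => x k ω) ∧
        ChristoffelSampling.regularized ε
            (ChristoffelSampling.discreteGram ρ φ u fun k => x k ω) ≤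
          (1 + Δ) • ChristoffelSampling.regularized ε (ChristoffelSampling.gram ρ φ)} := by
  have hpos : ∀ y, 0 < u y := fun y => (hk y).trans_le (huk y)
  -- For `n = 0` the inverse Christoffel function would be an empty sum, contradicting its
  -- positivity.
  have hne : Nonempty (Fin n) := by
    by_contra h
    have : IsEmpty (Fin n) := not_nonempty_iff.1 h
    obtain ⟨y⟩ := ρ.nonempty_of_neZero
    have := hk y
    simp [ChristoffelSampling.invChristoffel] at this
  have hL := ChristoffelSampling.l1Norm_pos hu hpos
  obtain ⟨D, hDunit, hDB, hDinv⟩ := ChristoffelSampling.exists_whitening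
    (ChristoffelSampling.regularized_posDef hφ hbasis ε)
  have hm0 : 0 < (m : ℝ) := by
    refine lt_of_lt_of_le ?_ hm
    have hd := ChristoffelSampling.half_le_numDim hφ hbasis hG
    have : 0 < Real.log (16 * ChristoffelSampling.numDim ρ φ ε / γ) := by
      refine Real.log_pos ?_
      rw [lt_div_iff₀ hγ0]
      linarith
    unfold ChristoffelSampling.cDelta
    positivity
  set W : Fin m → Ω → Matrix (Fin n) (Fin n) ℂ :=
    fun k ω => ChristoffelSampling.weightedOuter ρ φ u (x k ω)
  set G := ChristoffelSampling.gram ρ φ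
  have hup := ChristoffelSampling.measureReal_tail_le_half hφ hbasis hG hu hpos huk hΔ hγ0 hγ1 hm
    hindep hlaw hDB hDinv (σ := 1) (by norm_num)
  have hlow := ChristoffelSampling.measureReal_tail_le_half hφ hbasis hG hu hpos huk hΔ hγ0 hγ1 hm
    hindep hlaw hDB hDinv (σ := -1) (by norm_num)
  set bad : ℝ → Set Ω := fun σ =>
    {ω | ¬ σ • ∑ k, (D * W k ω * star D - D * G * star D) ≤ ((m : ℝ) * Δ) • 1} with hbad
  have hconj : ∀ ω, ∑ k, (D * W k ω * star D - D * G * star D) =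
      (m : ℝ) • (D * ChristoffelSampling.regularized ε
        (ChristoffelSampling.discreteGram ρ φ u fun k => x k ω) * star D - 1) := fun ω => by
    rw [← hDB, ChristoffelSampling.discreteGram_eq_smul_sum, ChristoffelSampling.regularized,
      ChristoffelSampling.regularized, ← sub_mul, ← mul_sub, add_sub_add_right_eq_sub,
      ← smul_mul_assoc, ← mul_smul_comm, smul_sub, smul_smul, mul_inv_cancel₀ hm0.ne', one_smul,
      Finset.sum_sub_distrib, ← Finset.sum_mul, ← Finset.mul_sum]
    simp [mul_sub, sub_mul, ← Nat.cast_smul_eq_nsmul ℝ]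
    rfl
  -- Covering the space and using subadditivity avoids any measurability of the good event.
  have hcover : Set.univ ⊆ {ω |
      (1 - Δ) • ChristoffelSampling.regularized ε G ≤ ChristoffelSampling.regularized ε
          (ChristoffelSampling.discreteGram ρ φ u fun k => x k ω) ∧
        ChristoffelSampling.regularized ε
          (ChristoffelSampling.discreteGram ρ φ u fun k => x k ω) ≤
          (1 + Δ) • ChristoffelSampling.regularized ε G} ∪ (bad 1 ∪ bad (-1)) := by
    intro ω _
    by_contra hω
    simp only [hbad, Set.mem_union, Set.mem_ofPred_eq, not_or, not_not] at hω
    obtain ⟨hω, h1, h2⟩ := hω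
    apply hω
    rw [hconj, smul_comm, mul_smul, smul_le_smul_iff_of_pos_left hm0] at h1 h2
    refine ⟨(ChristoffelSampling.whiten_le_iff hDunit).2 ?_,
      (ChristoffelSampling.whiten_le_iff hDunit).2 ?_⟩
    · rw [neg_one_smul, neg_sub] at h2
      rw [mul_smul_comm, smul_mul_assoc, hDB, sub_smul, one_smul]
      exact sub_le_comm.1 h2
    · rw [one_smul] at h1
      rw [mul_smul_comm, smul_mul_assoc, hDB, add_smul, one_smul]
      exact sub_le_iff_le_add'.1 h1
  have h := measureReal_mono (μ := P) hcover
  rw [probReal_univ] at h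
  have h' := h.trans ((measureReal_union_le _ _).trans
    (add_le_add_right (measureReal_union_le (bad 1) (bad (-1))) _))
  linarith
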